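/- Let $\sigma$ be the substitution $\sigma(a)=ab$, $\sigma(b)=ac$, $\sigma(c)=a$ on words over $\{a,b,c\}$, and let $\mathbb{T}$ be the Tribonacci sequence, the infinite fixed point of $\sigma$ beginning with $a$. Put $T_{-2}=\varepsilon$ (the empty word), $T_{-1}=c$, $T_m=\sigma^m(a)$ for $m\ge 0$, and $t_m=|T_m|$ for $m\ge -2$; for $m\geq 0$ the word $T_m$ is the prefix of $\mathbb{T}$ of length $t_m$. For $n\ge 0$ let $A(n)$ be the number of distinct nonempty words $\omega$ such that $\omega\omega$ is a factor (contiguous subword) of the prefix of $\mathbb{T}$ of length $n$; thus $A(t_m)$ is the number of distinct squares in $T_m$. Then $A(t_m)=0$ for $m=0,1,2$, and for every $m\ge 3$ $$A(t_m)=\tfrac12\bigl(2t_{m-2}+t_{m-3}+3t_{m-4}-m-5\bigr).$$ This agrees with Glen's formula: with $d_{-3}=d_{-2}=d_{-1}=-1$, $d_0=0$ and $d_j=\frac{t_{j+1}+t_{j-1}-3}{2}$ for $j\ge 1$, for every $m\ge 3$ $$A(t_m)=\sum_{i=0}^{m-3}(d_i+1)+d_{m-5}+d_{m-6}+1.$$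 -/

import Mathlib

namespace Tribonacci

/-- The three-letter alphabet. -/
inductive Letter
  | a
  | b
  | c
  deriving DecidableEq

/-- The images of the letters: `a ↦ ab`, `b ↦ ac`, `c ↦ a`. -/
def letterImage : Letter → List Letter
  | .a => [.a, .b]
  | .b => [.a, .c]
  | .c => [.a]

/-- The Tribonacci substitution `σ` on finite words. -/
def subst (w : List Letter) : List Letter := w.flatMap letterImage

/-- The words `T_m`: `T_m = σ^m(a)` for `m ≥ 0`, `T_{-1} = c`, `T_{-2} = ε`.
The value for `m < -2` is again the empty word. -/
def T : ℤ → List Letter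
  | .ofNat m => subst^[m] [.a]
  | .negSucc 0 => [.c]
  | .negSucc (_ + 1) => []

/-- The Tribonacci numbers `t_m = |T_m|`. -/
def t (m : ℤ) : ℕ := (T m).length

theorem T_natCast (m : ℕ) : T m = subst^[m] [.a] := rfl

theorem T_succ (m : ℕ) : T ((m + 1 : ℕ) : ℤ) = subst (T m) := by
  simp only [T_natCast, Function.iterate_succ_apply']

theorem subst_append (u v : List Letter) : subst (u ++ v) = subst u ++ subst v := by
  simp [subst]

theorem length_le_length_subst (w : List Letter) : w.length ≤ (subst w).length := by
  induction w with
  | nil => simp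
  | cons x w ih =>
    have h : subst (x :: w) = letterImage x ++ subst w := rfl
    rw [h, List.length_append, List.length_cons]
    cases x <;> simp [letterImage] <;> omega

theorem exists_T_succ (m : ℕ) :
    ∃ v : List Letter, 1 ≤ v.length ∧ T ((m + 1 : ℕ) : ℤ) = T m ++ v := by
  induction m with
  | zero => exact ⟨[.b], by simp, rfl⟩
  | succ m ih =>
    obtain ⟨v, hv, h⟩ := ih
    refine ⟨subst v, hv.trans (length_le_length_subst v), ?_⟩
    rw [T_succ (m + 1), h, subst_append, ← T_succ, h]

theorem T_prefix {m n : ℕ} (h : m ≤ n) : T m <+: T n := by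
  induction n, h using Nat.le_induction with
  | base => exact List.prefix_refl _
  | succ n _ ih =>
    obtain ⟨v, _, hv⟩ := exists_T_succ n
    rw [hv]
    exact ih.trans (List.prefix_append _ _)

theorem lt_length_T (m : ℕ) : m < (T m).length := by
  induction m with
  | zero => exact Nat.zero_lt_one
  | succ m ih =>
    obtain ⟨v, hv, h⟩ := exists_T_succ m
    rw [h, List.length_append]
    omega

/-- The Tribonacci sequence, the fixed point of `σ` beginning with `a`, that is the common
extension of all the words `σ^m(a)`. Letters are indexed from `0`, so `trib i` is the letter
of index `i + 1` in one-based notation. -/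
def trib (i : ℕ) : Letter := (T i)[i]'(lt_length_T i)

/-- The prefix of length `n` of the Tribonacci sequence. -/
def tribPrefix (n : ℕ) : List Letter := (List.range n).map trib

theorem trib_eq_getElem (m i : ℕ) (h : i < (T m).length) : trib i = (T m)[i] := by
  unfold trib
  rcases le_total m i with hmi | hmi
  · exact ((T_prefix hmi).getElem h).symm
  · exact (T_prefix hmi).getElem (lt_length_T i)

/-- `T_m` is the prefix of length `t_m` of the Tribonacci sequence. -/
theorem tribPrefix_t (m : ℕ) : tribPrefix (t m) = T m := by
  apply List.ext_getElem
  · simp [tribPrefix, t]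
  · intro i h1 h2
    simp [tribPrefix, trib_eq_getElem m i h2]

theorem tribPrefix_prefix {m n : ℕ} (h : m ≤ n) : tribPrefix m <+: tribPrefix n := by
  obtain ⟨k, rfl⟩ := Nat.exists_eq_add_of_le h
  rw [tribPrefix, tribPrefix, List.range_add, List.map_append]
  exact List.prefix_append _ _

theorem eq_tribPrefix_of_prefix {w : List Letter} {n : ℕ} (h : w <+: tribPrefix n) :
    w = tribPrefix w.length := by
  have hl : w.length ≤ n := by simpa [tribPrefix] using h.length_le
  have h2 := List.prefix_of_prefix_length_le h (tribPrefix_prefix hl) (by simp [tribPrefix])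
  exact h2.eq_of_length (by simp [tribPrefix])

/-- The Tribonacci sequence begins with `a`. -/
theorem trib_zero : trib 0 = .a := rfl

/-- The Tribonacci sequence is fixed by `σ`: `σ` maps prefixes to prefixes. -/
theorem subst_tribPrefix (n : ℕ) :
    subst (tribPrefix n) = tribPrefix (subst (tribPrefix n)).length := by
  have h1 : tribPrefix n <+: T n := by
    rw [← tribPrefix_t]
    exact tribPrefix_prefix (lt_length_T n).le
  obtain ⟨v, hv⟩ := h1
  refine eq_tribPrefix_of_prefix (n := t ((n + 1 : ℕ) : ℤ)) ?_
  rw [tribPrefix_t, T_succ, ← hv, subst_append]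
  exact List.prefix_append _ _

/-- The nonempty words `ω` such that the square `ωω` is a factor (contiguous subword)
of the prefix of length `n` of the Tribonacci sequence. -/
def squareRoots (n : ℕ) : Set (List Letter) :=
  {w | w ≠ [] ∧ w ++ w <:+: tribPrefix n}

theorem squareRoots_finite (n : ℕ) : (squareRoots n).Finite := by
  refine Set.Finite.subset (List.finite_toSet (tribPrefix n).sublists) ?_
  rintro w ⟨_, h⟩
  simp only [Set.mem_ofPred_eq, List.mem_sublists]
  exact (List.sublist_append_left w w).trans h.sublist

/-- `A n` is the number of distinct squares in the prefix of length `n` of the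
Tribonacci sequence. -/
noncomputable def A (n : ℕ) : ℕ := (squareRoots n).ncard

/-- The numbers `d_j` of Glen's formula: `d_j = -1` for `j < 0`, `d_0 = 0` and
`d_j = (t_{j+1} + t_{j-1} - 3) / 2` for `j ≥ 1`. -/
def d (j : ℤ) : ℚ :=
  if j < 0 then -1
  else if j = 0 then 0
  else ((t (j + 1) : ℚ) + (t (j - 1) : ℚ) - 3) / 2

end Tribonacci

/-! Write `b_k` for `bispecialLength k` and `tau k` for |σ^k(a)|. A repetition of period q is an
agreement between positions s and s + q. Extended maximally to the left, such an agreement can be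
desubstituted, because the images ab, ac, a are marked by their initial a. Iterating down to the
empty agreement shows that its two positions are starts of σ^k-images and that its length is at most
`b_k` (`Agree.exists_iterate`). If the length is at least the period, the two positions come from
adjacent letters, so the period is |σ^k(x)| for a letter x (`exists_letter`).

Conversely, every σ^k-image start is followed by the prefix of length `b_k`, so each letter x does
generate such a repetition. Since |σ^(k+1)(c)| = `tau k` and |σ^(k+2)(b)| = `tau (k + 1) + tau k`,
only two families of periods occur. The period `tau k` yields `b_k + 1 - tau k` squares from the
letter a, and all `tau k` conjugates from c; the period `tau (k + 1) + tau k` yields `b_k + 1`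
squares. Different offsets below the period give different words (`IsPeriod.factor_ne`).

It remains to see which repetitions fit in the prefix of length `tau (l + 3)`. Those of b and c fit
exactly for k < l, those of a for k < l + 2. This gives `A_tau`; the closed forms follow from 2
`b_k` + 3 + `tau k` = `tau (k + 2)` and `d k = b_k`. -/

namespace Tribonacci

/-! ### Positions of the images of letters. -/

/-- The position in the Tribonacci sequence at which the image of its `i`-th letter begins. -/
def imagePos (i : ℕ) : ℕ := (subst (tribPrefix i)).length

theorem tribPrefix_succ (i : ℕ) : tribPrefix (i + 1) = tribPrefix i ++ [trib i] := by
  simp [tribPrefix, List.range_succ]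

theorem tribPrefix_imagePos_succ (i : ℕ) :
    tribPrefix (imagePos (i + 1)) = tribPrefix (imagePos i) ++ letterImage (trib i) := by
  unfold imagePos
  rw [← subst_tribPrefix, ← subst_tribPrefix, tribPrefix_succ, subst_append]
  simp [subst]

theorem imagePos_zero : imagePos 0 = 0 := rfl

theorem imagePos_succ (i : ℕ) :
    imagePos (i + 1) = imagePos i + (letterImage (trib i)).length := by
  simpa [tribPrefix] using congrArg List.length (tribPrefix_imagePos_succ i)

theorem trib_imagePos_add (i r : ℕ) (h : r < (letterImage (trib i)).length) :
    trib (imagePos i + r) = (letterImage (trib i))[r] := by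
  have h1 : imagePos i + r < (tribPrefix (imagePos (i + 1))).length := by
    simp [tribPrefix, imagePos_succ, h]
  have h2 : trib (imagePos i + r) = (tribPrefix (imagePos (i + 1)))[imagePos i + r] := by
    simp [tribPrefix]
  rw [h2]
  simp only [tribPrefix_imagePos_succ]
  rw [List.getElem_append_right (by simp [tribPrefix])]
  simp [tribPrefix]

theorem trib_imagePos (i : ℕ) : trib (imagePos i) = .a := by
  have h := trib_imagePos_add i 0 (by cases trib i <;> simp [letterImage])
  rw [Nat.add_zero] at h
  rw [h]
  cases trib i <;> rfl

/-- The letter that follows the initial `a` of the image of a letter. -/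
def nextLetter : Letter → Letter
  | .a => .b
  | .b => .c
  | .c => .a

theorem nextLetter_injective : Function.Injective nextLetter := by
  intro x y h
  cases x <;> cases y <;> simp_all [nextLetter]

theorem trib_imagePos_add_one (i : ℕ) : trib (imagePos i + 1) = nextLetter (trib i) := by
  have h := trib_imagePos_add i 1
  have h2 := imagePos_succ i
  have h3 := trib_imagePos (i + 1)
  rcases hx : trib i with _ | _ | _ <;> simp [hx, letterImage, nextLetter] at h h2 ⊢
  · exact h
  · exact h
  · rwa [h2] at h3

/-- The last letters of ab, ac, a happen to be given by the same injective map, so a letter can be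
recovered from either end of its image. -/
theorem trib_imagePos_succ_sub_one (i : ℕ) :
    trib (imagePos (i + 1) - 1) = nextLetter (trib i) := by
  have h1 := trib_imagePos_add_one i
  have h2 := imagePos_succ i
  have h3 := trib_imagePos i
  rcases hx : trib i with _ | _ | _ <;> simp [hx, letterImage, nextLetter] at h1 h2 ⊢
  · rw [h2]; exact h1
  · rw [h2]; exact h1
  · rw [h2]; exact h3

theorem imagePos_lt_succ (i : ℕ) : imagePos i < imagePos (i + 1) := by
  rw [imagePos_succ]
  cases trib i <;> simp [letterImage]

theorem imagePos_succ_le (i : ℕ) : imagePos (i + 1) ≤ imagePos i + 2 := by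
  rw [imagePos_succ]
  cases trib i <;> simp [letterImage]

theorem imagePos_strictMono : StrictMono imagePos := strictMono_nat_of_lt_succ imagePos_lt_succ

theorem exists_imagePos_le (n : ℕ) : ∃ i, imagePos i ≤ n ∧ n < imagePos (i + 1) := by
  induction n with
  | zero => exact ⟨0, le_refl _, imagePos_lt_succ 0⟩
  | succ n ih =>
    obtain ⟨i, h1, h2⟩ := ih
    rcases Nat.lt_or_ge (n + 1) (imagePos (i + 1)) with h | h
    · exact ⟨i, by omega, h⟩
    · have := imagePos_lt_succ (i + 1)
      exact ⟨i + 1, h, by omega⟩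

theorem eq_imagePos_or (n : ℕ) :
    (∃ i, n = imagePos i) ∨ ∃ i, n = imagePos i + 1 ∧ n + 1 = imagePos (i + 1) := by
  obtain ⟨i, h1, h2⟩ := exists_imagePos_le n
  have := imagePos_succ_le i
  rcases Nat.eq_or_lt_of_le h1 with h | h
  · exact .inl ⟨i, h.symm⟩
  · exact .inr ⟨i, by omega, by omega⟩

theorem exists_eq_imagePos {n : ℕ} (h : trib n = .a) : ∃ i, n = imagePos i := by
  rcases eq_imagePos_or n with h1 | ⟨i, h1, h2⟩
  · exact h1
  · have h3 := trib_imagePos_succ_sub_one i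
    have h4 := imagePos_succ i
    rw [← h2, Nat.add_sub_cancel, h] at h3
    rcases hx : trib i with _ | _ | _ <;> simp [hx, nextLetter, letterImage] at h3 h4
    exact ⟨i + 1, by omega⟩

theorem trib_neighbours {n : ℕ} (h : trib n ≠ .a) :
    0 < n ∧ trib (n - 1) = .a ∧ trib (n + 1) = .a := by
  rcases eq_imagePos_or n with ⟨i, rfl⟩ | ⟨i, h1, h2⟩
  · exact absurd (trib_imagePos i) h
  · refine ⟨by omega, ?_, h2 ▸ trib_imagePos _⟩
    rw [h1, Nat.add_sub_cancel]
    exact trib_imagePos i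

/-! ### Agreements between positions, their images and preimages. -/

/-- The factors of length `e` at the positions `i` and `j` agree. -/
def Agree (i j e : ℕ) : Prop := ∀ r < e, trib (i + r) = trib (j + r)

theorem Agree.symm {i j e : ℕ} (h : Agree i j e) : Agree j i e := fun r hr => (h r hr).symm

theorem Agree.trans {i j k e : ℕ} (h : Agree i j e) (h' : Agree j k e) : Agree i k e :=
  fun r hr => (h r hr).trans (h' r hr)

theorem Agree.mono {i j e e' : ℕ} (h : Agree i j e) (he : e' ≤ e) : Agree i j e' :=
  fun r hr => h r (by omega)

theorem Agree.shift {i j e : ℕ} (h : Agree i j e) (s e' : ℕ) (hs : s + e' ≤ e) :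
    Agree (i + s) (j + s) e' := by
  intro r hr
  rw [Nat.add_assoc, Nat.add_assoc]
  exact h _ (by omega)

theorem Agree.imagePos_add {i j e : ℕ} (h : Agree i j e) {r : ℕ} (hr : r ≤ e) :
    imagePos (i + r) + imagePos j = imagePos (j + r) + imagePos i := by
  induction r with
  | zero => simp [Nat.add_comm]
  | succ r ih =>
    have h1 := ih (by omega)
    have h2 := h r (by omega)
    rw [← Nat.add_assoc, ← Nat.add_assoc, imagePos_succ, imagePos_succ, h2]
    omega

/-- The extra 1 is the letter a that begins the image of whatever comes next. -/
theorem Agree.image {i j e : ℕ} (h : Agree i j e) :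
    Agree (imagePos i) (imagePos j) (imagePos (i + e) - imagePos i + 1) := by
  intro r hr
  have hm := imagePos_strictMono.monotone
  have hie := hm (Nat.le_add_right i e)
  have key : ∀ p, imagePos i + r = imagePos p → trib (imagePos i + r) = trib (imagePos j + r) := by
    intro p hp
    have h1 : i ≤ p := imagePos_strictMono.le_iff_le.1 (by omega)
    have h2 : p ≤ i + e := imagePos_strictMono.le_iff_le.1 (by omega)
    obtain ⟨v, rfl⟩ := Nat.exists_eq_add_of_le h1
    have h3 := h.imagePos_add (r := v) (by omega)
    rw [hp, trib_imagePos, show imagePos j + r = imagePos (j + v) by omega, trib_imagePos]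
  rcases eq_imagePos_or (imagePos i + r) with ⟨p, hp⟩ | ⟨p, hp, hp'⟩
  · exact key p hp
  · have h1 : i < p + 1 := imagePos_strictMono.lt_iff_lt.1 (by omega)
    have h2 : p < i + e := imagePos_strictMono.lt_iff_lt.1 (by omega)
    obtain ⟨v, rfl⟩ := Nat.exists_eq_add_of_le (Nat.le_of_lt_succ h1)
    have h3 := h.imagePos_add (r := v) (by omega)
    rw [hp, trib_imagePos_add_one, show imagePos j + r = imagePos (j + v) + 1 by omega,
      trib_imagePos_add_one, h v (by omega)]

/-- No pair of equal letters precedes the positions `i` and `j`. -/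
def LeftMaximal (i j : ℕ) : Prop := i = 0 ∨ trib (i - 1) ≠ trib (j - 1)

/-- A left-maximal nonempty agreement starts with a, since b and c are always preceded by a; hence
both positions are image starts. Left-maximality passes to the preimage because distinct letters
have images with distinct last letters. -/
theorem Agree.exists_preimage {i j e : ℕ} (h : Agree i j e) (hl : LeftMaximal i j) (hij : i < j)
    (he : 0 < e) :
    ∃ i' j' e', i' < j' ∧ e' < e ∧ i = imagePos i' ∧ j = imagePos j' ∧ Agree i' j' e' ∧
      LeftMaximal i' j' ∧ e ≤ imagePos (i' + e') - imagePos i' + 1 := by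
  have hh : trib i = trib j := h 0 he
  have hi : trib i = .a := by
    by_contra hne
    obtain ⟨h1, h2, -⟩ := trib_neighbours hne
    rw [hh] at hne
    obtain ⟨-, h4, -⟩ := trib_neighbours hne
    rcases hl with hl | hl
    · omega
    · exact hl (h2.trans h4.symm)
  obtain ⟨i', rfl⟩ := exists_eq_imagePos hi
  obtain ⟨j', rfl⟩ := exists_eq_imagePos (hh ▸ hi)
  have hij' : i' < j' := imagePos_strictMono.lt_iff_lt.1 hij
  have hl' : LeftMaximal i' j' := by
    rcases Nat.eq_zero_or_pos i' with h0 | h0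
    · exact .inl h0
    · refine .inr fun heq => ?_
      obtain ⟨u, rfl⟩ := Nat.exists_eq_succ_of_ne_zero h0.ne'
      obtain ⟨v, rfl⟩ := Nat.exists_eq_succ_of_ne_zero (show j' ≠ 0 by omega)
      rcases hl with hl | hl
      · have := imagePos_lt_succ u
        simp only [Nat.succ_eq_add_one] at hl
        omega
      · refine hl ?_
        simp only [Nat.succ_eq_add_one, Nat.add_sub_cancel] at heq ⊢
        rw [trib_imagePos_succ_sub_one, trib_imagePos_succ_sub_one, heq]
  classical
  -- Take the longest agreement of the preimages whose image stays inside the given one.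
  let P : ℕ → Prop := fun n => Agree i' j' n ∧ imagePos (i' + n) ≤ imagePos i' + e
  have hP : P (Nat.findGreatest P e) :=
    Nat.findGreatest_spec (P := P) (Nat.zero_le e)
      ⟨fun r hr => absurd hr (Nat.not_lt_zero r), by simp⟩
  have hmax : ∀ n, n ≤ e → P n → n ≤ Nat.findGreatest P e := fun n hn hp =>
    Nat.le_findGreatest hn hp
  have hle : Nat.findGreatest P e ≤ e := Nat.findGreatest_le e
  generalize Nat.findGreatest P e = e' at hP hmax hle
  -- The first image has length 2: a common letter c would be preceded by a on both sides, against
  -- left-maximality.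
  have hlt : e' < e := by
    rcases Nat.eq_zero_or_pos e' with h0 | h0
    · omega
    have hc : trib i' ≠ .c := by
      intro hc
      have hcj : trib j' = .c := by rw [← hc]; exact (hP.1 0 h0).symm
      obtain ⟨h1, h2, -⟩ := trib_neighbours (n := i') (by rw [hc]; decide)
      obtain ⟨-, h4, -⟩ := trib_neighbours (n := j') (by rw [hcj]; decide)
      rcases hl' with hl' | hl'
      · omega
      · exact hl' (h2.trans h4.symm)
    have h1 : imagePos (i' + 1) = imagePos i' + 2 := by
      rw [imagePos_succ]
      rcases hx : trib i' with _ | _ | _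
      · rfl
      · rfl
      · exact absurd hx hc
    have h2 := imagePos_strictMono.add_le_nat (e' - 1) (i' + 1)
    rw [show e' - 1 + (i' + 1) = i' + e' by omega] at h2
    have := hP.2
    omega
  refine ⟨i', j', e', hij', hlt, rfl, rfl, hP.1, hl', ?_⟩
  -- Otherwise the letter after the final a also agrees; it determines the next letter of the
  -- preimage, so e' + 1 would qualify.
  by_contra hcon
  have hmono := imagePos_strictMono.monotone (Nat.le_add_right i' e')
  have h1 := hP.1.imagePos_add (le_refl e')
  have h2 := h (imagePos (i' + e') - imagePos i' + 1) (by omega)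
  rw [show imagePos i' + (imagePos (i' + e') - imagePos i' + 1) = imagePos (i' + e') + 1 by omega,
    show imagePos j' + (imagePos (i' + e') - imagePos i' + 1) = imagePos (j' + e') + 1 by omega,
    trib_imagePos_add_one, trib_imagePos_add_one] at h2
  have h3 := nextLetter_injective h2
  have h4 := imagePos_succ_le (i' + e')
  have h5 := hmax (e' + 1) (by omega) ⟨fun r hr => by
    rcases Nat.lt_succ_iff_lt_or_eq.1 hr with hr | rfl
    · exact hP.1 r hr
    · exact h3, by rw [← Nat.add_assoc]; omega⟩
  omega

/-! ### Bispecial prefixes bound all left-maximal agreements. -/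

/-- The length of the `k`-th bispecial factor of the Tribonacci sequence. -/
def bispecialLength : ℕ → ℕ
  | 0 => 0
  | k + 1 => imagePos (bispecialLength k) + 1

theorem agree_zero_iterate (k i : ℕ) : Agree 0 (imagePos^[k] i) (bispecialLength k) := by
  induction k with
  | zero => exact fun r hr => absurd hr (Nat.not_lt_zero r)
  | succ k ih =>
    have h := ih.image
    rw [Function.iterate_succ_apply', bispecialLength]
    simpa [imagePos_zero] using h

theorem Agree.exists_iterate {e : ℕ} : ∀ {i j : ℕ}, Agree i j e → LeftMaximal i j → i < j →
    ∃ k i' j', i' < j' ∧ i = imagePos^[k] i' ∧ j = imagePos^[k] j' ∧ e ≤ bispecialLength k := by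
  induction e using Nat.strong_induction_on with
  | _ e ih =>
    intro i j h hl hij
    rcases Nat.eq_zero_or_pos e with rfl | he
    · exact ⟨0, i, j, hij, rfl, rfl, le_refl _⟩
    obtain ⟨i', j', e', hij', hlt, rfl, rfl, h', hl', hb⟩ := h.exists_preimage hl hij he
    obtain ⟨k, u, v, huv, rfl, rfl, hk⟩ := ih e' hlt h' hl' hij'
    refine ⟨k + 1, u, v, huv, ?_, ?_, ?_⟩
    · rw [Function.iterate_succ_apply']
    · rw [Function.iterate_succ_apply']
    -- As e' ≤ `b_k`, the factor at the preimage position is a prefix of the sequence, so its image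
    -- has length `imagePos e'`.
    · have h1 := (agree_zero_iterate k u).imagePos_add hk
      have h2 := imagePos_strictMono.monotone hk
      rw [Nat.zero_add, imagePos_zero] at h1
      rw [bispecialLength]
      omega

theorem exists_leftMaximal {s q e : ℕ} (h : Agree s (s + q) e) :
    ∃ i j, s = i + j ∧ LeftMaximal i (i + q) ∧ Agree i (i + q) (e + j) := by
  induction s generalizing e with
  | zero => exact ⟨0, 0, rfl, .inl rfl, h⟩
  | succ s ih =>
    by_cases heq : trib s = trib (s + q)
    · have h1 : Agree s (s + q) (e + 1) := by
        intro r hr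
        rcases r with _ | r
        · exact heq
        · have := h r (by omega)
          rw [show s + (r + 1) = s + 1 + r by omega, show s + q + (r + 1) = s + 1 + q + r by omega]
          exact this
      obtain ⟨i, j, rfl, hl, hm⟩ := ih h1
      exact ⟨i, j + 1, rfl, hl, by rwa [show e + (j + 1) = e + 1 + j by omega]⟩
    · exact ⟨s + 1, 0, rfl, .inr (by simpa [show s + 1 + q - 1 = s + q by omega] using heq), h⟩

/-! ### Lengths of iterated images, and the possible repetitions. -/

/-- The length of the image of a letter under the `k`-th power of the substitution. -/
def imageLength : ℕ → Letter → ℕ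
  | 0, _ => 1
  | k + 1, .a => imageLength k .a + imageLength k .b
  | k + 1, .b => imageLength k .a + imageLength k .c
  | k + 1, .c => imageLength k .a

theorem iterate_imagePos_succ (k i : ℕ) :
    imagePos^[k] (i + 1) = imagePos^[k] i + imageLength k (trib i) := by
  induction k generalizing i with
  | zero => rfl
  | succ k ih =>
    rw [Function.iterate_succ_apply, Function.iterate_succ_apply]
    have h0 := ih (imagePos i)
    have h1 := ih (imagePos i + 1)
    have h2 := imagePos_succ i
    rw [trib_imagePos] at h0
    rw [trib_imagePos_add_one] at h1
    rcases hx : trib i with _ | _ | _ <;>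
      simp only [hx, letterImage, nextLetter, imageLength, List.length_cons,
        List.length_nil] at h1 h2 ⊢
    · rw [h2, h1, h0]; omega
    · rw [h2, h1, h0]; omega
    · rw [h2, h0]

theorem iterate_imagePos_zero (k : ℕ) : imagePos^[k] 0 = 0 := by
  induction k with
  | zero => rfl
  | succ k ih => rw [Function.iterate_succ_apply', ih, imagePos_zero]

theorem iterate_imagePos_strictMono (k : ℕ) : StrictMono imagePos^[k] :=
  imagePos_strictMono.iterate k

theorem iterate_imagePos_one (k : ℕ) : imagePos^[k] 1 = imageLength k .a := by
  have h := iterate_imagePos_succ k 0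
  rwa [iterate_imagePos_zero, Nat.zero_add, Nat.zero_add] at h

theorem t_natCast (k : ℕ) : t k = imageLength k .a := by
  rw [← iterate_imagePos_one]
  induction k with
  | zero => rfl
  | succ k ih =>
    rw [Function.iterate_succ_apply', ← ih, imagePos, tribPrefix_t, ← T_succ, t]

theorem bispecialLength_succ (k : ℕ) :
    bispecialLength (k + 1) = bispecialLength k + imageLength k .a := by
  induction k with
  | zero => rfl
  | succ k ih =>
    have h := (agree_zero_iterate k 1).imagePos_add (le_refl _)
    rw [Nat.zero_add, imagePos_zero, ← Function.iterate_succ_apply' imagePos,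
      iterate_imagePos_one, iterate_imagePos_one] at h
    have h1 : bispecialLength (k + 1) = imagePos (bispecialLength k) + 1 := rfl
    have h2 : bispecialLength (k + 1 + 1) = imagePos (bispecialLength (k + 1)) + 1 := rfl
    rw [ih, Nat.add_comm (bispecialLength k)] at h2
    simp only [Nat.succ_eq_add_one] at h
    omega

/-- These are proved together because the induction needs them together. The bound `b_k` < |σ^k(a)|
+ |σ^k(c)| rules out periods spanning two letters; |σ^k(a)| ≤ `b_k` + 1 ensures that all conjugates
of σ^k(a) occur as roots. -/
theorem imageLength_bounds (k : ℕ) :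
    0 < imageLength k .c ∧ imageLength k .c ≤ imageLength k .b ∧
      imageLength k .b ≤ imageLength k .a ∧ imageLength k .b ≤ 2 * imageLength k .c ∧
      bispecialLength k < imageLength k .a + imageLength k .c ∧
      imageLength k .a ≤ bispecialLength k + 1 := by
  induction k with
  | zero => simp [imageLength, bispecialLength]
  | succ k ih =>
    have := bispecialLength_succ k
    simp only [imageLength]
    omega

/-- After the two equal images, the prefix of length `b_k` follows in both places. -/
theorem agree_iterate {i j : ℕ} (h : trib i = trib j) (k : ℕ) :
    Agree (imagePos^[k] i) (imagePos^[k] j) (imageLength k (trib i) + bispecialLength k) := by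
  induction k with
  | zero =>
    intro r hr
    obtain rfl : r = 0 := by simpa [imageLength, bispecialLength] using hr
    exact h
  | succ k ih =>
    have h1 := ih.image
    have h2 := (agree_zero_iterate k (i + 1)).imagePos_add (le_refl _)
    rw [Nat.zero_add, imagePos_zero, ← Function.iterate_succ_apply' imagePos,
      iterate_imagePos_succ (k + 1)] at h2
    rw [← Nat.add_assoc, ← iterate_imagePos_succ k, ← Function.iterate_succ_apply' imagePos,
      ← Function.iterate_succ_apply' imagePos] at h1
    refine h1.mono ?_
    rw [bispecialLength]
    simp only [Nat.succ_eq_add_one] at h2 ⊢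
    omega

theorem agree_iterate_add (k i : ℕ) :
    Agree (imagePos^[k] i) (imagePos^[k] i + imageLength k (trib i)) (bispecialLength k) := by
  rw [← iterate_imagePos_succ]
  exact (agree_zero_iterate k i).symm.trans (agree_zero_iterate k (i + 1))

/-- Every repetition of exponent at least two is an image of a single letter. -/
theorem exists_letter {s q e : ℕ} (hq : 0 < q) (hqe : q ≤ e) (h : Agree s (s + q) e) :
    ∃ k i j, s = imagePos^[k] i + j ∧ q = imageLength k (trib i) ∧ e + j ≤ bispecialLength k := by
  obtain ⟨i, j, rfl, hl, hm⟩ := exists_leftMaximal h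
  obtain ⟨k, i', j', hij, rfl, h2, h3⟩ := hm.exists_iterate hl (by omega)
  refine ⟨k, i', j, rfl, ?_, h3⟩
  have h4 := iterate_imagePos_succ k i'
  rcases Nat.eq_or_lt_of_le (Nat.succ_le_of_lt hij) with h5 | h5
  · rw [← h5, Nat.succ_eq_add_one] at h2
    omega
  -- A period spanning two letters, one of which is a, is at least |σ^k(a)| + |σ^k(c)|, which
  -- exceeds `b_k` and so the length of the agreement.
  · exfalso
    have h6 := (iterate_imagePos_strictMono k).monotone (Nat.succ_le_of_lt h5)
    have h7 := iterate_imagePos_succ k (i' + 1)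
    have hb := imageLength_bounds k
    have hne : trib i' = .a ∨ trib (i' + 1) = .a := by
      by_contra hcon
      rw [not_or] at hcon
      exact hcon.2 (trib_neighbours hcon.1).2.2
    simp only [Nat.succ_eq_add_one] at h6
    have hc : ∀ x, imageLength k .c ≤ imageLength k x := by
      intro x
      cases x <;> omega
    have hc1 := hc (trib i')
    have hc2 := hc (trib (i' + 1))
    rcases hne with hne | hne
    · rw [hne] at h4
      omega
    · rw [hne] at h7
      omega

/-! ### Squares as agreements of length equal to the period. -/

/-- The factor of length `q` at the position `s`. -/
def factor (s q : ℕ) : List Letter := (List.range q).map fun r => trib (s + r)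

theorem length_factor (s q : ℕ) : (factor s q).length = q := by simp [factor]

theorem factor_eq_iff {s s' q : ℕ} : factor s q = factor s' q ↔ Agree s s' q := by
  simp [factor, Agree]

theorem factor_add (s p q : ℕ) : factor s (p + q) = factor s p ++ factor (s + p) q := by
  simp [factor, List.range_add, Nat.add_assoc]

theorem isInfix_tribPrefix_iff {w : List Letter} {n : ℕ} :
    w <:+: tribPrefix n ↔ ∃ s, s + w.length ≤ n ∧ w = factor s w.length := by
  have hp : ∀ n, tribPrefix n = factor 0 n := fun n => by simp [tribPrefix, factor]
  constructor
  · rintro ⟨u, v, h⟩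
    have hl := congrArg List.length h
    rw [hp, length_factor, List.length_append, List.length_append] at hl
    refine ⟨u.length, by omega, ?_⟩
    rw [hp, ← hl, factor_add, factor_add, Nat.zero_add] at h
    have h1 := List.append_inj_left h (by simp [length_factor])
    exact List.append_inj_right h1 (by simp [length_factor])
  · rintro ⟨s, hs, hw⟩
    obtain ⟨r, rfl⟩ := Nat.exists_eq_add_of_le hs
    refine ⟨factor 0 s, factor (s + w.length) r, ?_⟩
    rw [hp, factor_add, factor_add, Nat.zero_add, Nat.zero_add, ← hw]

theorem mem_squareRoots_iff {w : List Letter} {n : ℕ} :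
    w ∈ squareRoots n ↔
      ∃ s q, 0 < q ∧ s + 2 * q ≤ n ∧ Agree s (s + q) q ∧ w = factor s q := by
  have hdef : w ∈ squareRoots n ↔ w ≠ [] ∧ w ++ w <:+: tribPrefix n := Iff.rfl
  rw [hdef, isInfix_tribPrefix_iff]
  constructor
  · rintro ⟨h0, s, hs, hw⟩
    rw [List.length_append] at hs hw
    rw [factor_add] at hw
    have h1 := List.append_inj_left hw (by simp [length_factor])
    have h2 := List.append_inj_right hw (by simp [length_factor])
    exact ⟨s, w.length, List.length_pos_iff.2 h0, by omega, factor_eq_iff.1 (h1.symm.trans h2), h1⟩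
  · rintro ⟨s, q, hq, hs, ha, rfl⟩
    refine ⟨fun h => ?_, s, ?_, ?_⟩
    · have := length_factor s q
      rw [h] at this
      simp at this
      omega
    · rw [List.length_append, length_factor]
      omega
    · rw [List.length_append, length_factor, factor_add, ← factor_eq_iff.2 ha]

/-! ### The two families of periods, and distinctness of conjugates. -/

/-- The length `|σ^k(a)|`, with a natural index. -/
abbrev tau (k : ℕ) : ℕ := imageLength k .a

theorem tau_add_three (k : ℕ) : tau (k + 3) = tau (k + 2) + tau (k + 1) + tau k := by
  simp only [tau, imageLength]
  omega

theorem imageLength_b (k : ℕ) : imageLength (k + 2) .b = tau (k + 1) + tau k := rfl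

theorem imageLength_c (k : ℕ) : imageLength (k + 1) .c = tau k := rfl

theorem tau_pos (k : ℕ) : 0 < tau k := by
  have := imageLength_bounds k
  simp only [tau]
  omega

theorem tau_strictMono : StrictMono tau := by
  refine strictMono_nat_of_lt_succ fun k => ?_
  have := imageLength_bounds k
  simp only [tau, imageLength]
  omega

theorem tau_add_lt (k : ℕ) : tau (k + 1) + tau k < tau (k + 2) := by
  have := imageLength_bounds k
  simp only [tau, imageLength]
  omega

theorem bispecialLength_lt (k : ℕ) : bispecialLength k < 2 * tau k := by
  have := imageLength_bounds k
  simp only [tau]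
  omega

theorem bispecialLength_lt_tau_succ (k : ℕ) : bispecialLength k < tau (k + 1) := by
  have := imageLength_bounds k
  simp only [tau, imageLength]
  omega

theorem tau_le (k : ℕ) : tau k ≤ bispecialLength k + 1 := (imageLength_bounds k).2.2.2.2.2

theorem bispecialLength_add_two (k : ℕ) :
    bispecialLength (k + 2) = bispecialLength k + tau k + tau (k + 1) := by
  rw [bispecialLength_succ, bispecialLength_succ]

/-- The lengths of the roots of the squares in the Tribonacci sequence. -/
def IsPeriod (q : ℕ) : Prop := (∃ k, q = tau k) ∨ ∃ k, q = tau (k + 1) + tau k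

theorem IsPeriod.le {q k : ℕ} (hq : IsPeriod q) (h : tau (k + 1) < q) :
    tau (k + 1) + tau k ≤ q := by
  rcases hq with ⟨n, rfl⟩ | ⟨n, rfl⟩
  · have h1 := tau_strictMono.lt_iff_lt.1 h
    have h2 := tau_strictMono.monotone (Nat.succ_le_of_lt h1)
    have h3 := tau_add_lt k
    simp only [Nat.succ_eq_add_one] at h2
    exact h3.le.trans h2
  · rcases Nat.lt_or_ge n k with h1 | h1
    · have h2 := tau_strictMono.monotone (Nat.succ_le_of_lt (Nat.succ_lt_succ h1))
      have h3 := tau_add_lt n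
      simp only [Nat.succ_eq_add_one] at h2
      exact absurd (h3.trans_le h2) h.not_gt
    · exact Nat.add_le_add (tau_strictMono.monotone (Nat.succ_le_succ h1))
        (tau_strictMono.monotone h1)

/-- Distinct conjugates of the root of a square are distinct words. -/
theorem IsPeriod.factor_ne {q s s' : ℕ} (hq : IsPeriod q) (hs : Agree s (s + q) q)
    (hs' : Agree s' (s' + q) q) (h : s < s') (hlt : s' < s + q) : factor s q ≠ factor s' q := by
  intro heq
  rw [factor_eq_iff] at heq
  obtain ⟨δ, rfl⟩ := Nat.exists_eq_add_of_le h.le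
  -- Equal roots make the whole squares equal, so the overlap is a repetition of period δ < q and
  -- agreement length 2q; no letter can generate one that long.
  have hm : Agree s (s + δ) (2 * q) := by
    intro r hr
    rcases Nat.lt_or_ge r q with h1 | h1
    · exact heq r h1
    · obtain ⟨u, rfl⟩ := Nat.exists_eq_add_of_le h1
      rw [← Nat.add_assoc, ← Nat.add_assoc, ← hs u (by omega), ← hs' u (by omega)]
      exact heq u (by omega)
  obtain ⟨k, i, j, -, h2, h3⟩ := exists_letter (by omega) (by omega) hm
  have hb := imageLength_bounds k
  rcases hx : trib i with _ | _ | _ <;> rw [hx] at h2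
  · omega
  · rcases k with _ | k
    · simp [imageLength] at *
      omega
    · have := imageLength_bounds k
      simp only [imageLength] at h2 hb
      omega
  · rcases k with _ | _ | k
    · simp [bispecialLength] at h3
      omega
    · have : bispecialLength (0 + 1) = 1 := rfl
      omega
    · rw [imageLength_c] at h2
      -- For x = c the length bounds alone do not suffice: the gap between `tau (k + 1)` and the
      -- next admissible period is needed.
      have h4 := hq.le (k := k) (by omega)
      have h6 : tau (k + 2) + tau (k + 1) ≤ 2 * (tau (k + 1) + tau k) := by
        have := imageLength_bounds k
        simp only [tau, imageLength]
        omega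
      rw [imageLength_c] at hb
      simp only [tau, Nat.add_assoc, Nat.reduceAdd] at *
      omega

/-! ### Enumeration of the square roots in a prefix. -/

/-- The root of length `tau k` at the offset `j` in the maximal repetition of that period. -/
def rootA (p : (_ : ℕ) × ℕ) : List Letter := factor (imagePos^[p.1 + 1] 3 + p.2) (tau p.1)

/-- The root of length `tau (k + 1) + tau k` at the offset `j` in the maximal repetition of
that period. -/
def rootB (p : (_ : ℕ) × ℕ) : List Letter :=
  factor (imagePos^[p.1 + 2] 1 + p.2) (tau (p.1 + 1) + tau p.1)

/-- The indices of the roots `rootA` of squares in the prefix of length `tau (l + 3)`. -/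
def indexA (l : ℕ) : Finset ((_ : ℕ) × ℕ) :=
  (Finset.range (l + 2)).sigma fun k =>
    -- For k < l the repetition at the first c fits and supplies every conjugate. For k = l and k =
    -- l + 1 only the repetition of a, available at position 0, contributes.
    Finset.range (if k < l then tau k else bispecialLength k + 1 - tau k)

/-- The indices of the roots `rootB` of squares in the prefix of length `tau (l + 3)`. -/
def indexB (l : ℕ) : Finset ((_ : ℕ) × ℕ) :=
  (Finset.range l).sigma fun k => Finset.range (bispecialLength k + 1)

theorem mem_indexA_iff {l k j : ℕ} : ⟨k, j⟩ ∈ indexA l ↔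
    k < l + 2 ∧ j < if k < l then tau k else bispecialLength k + 1 - tau k := by
  simp [indexA]

theorem mem_indexB_iff {l k j : ℕ} : ⟨k, j⟩ ∈ indexB l ↔ k < l ∧ j < bispecialLength k + 1 := by
  simp [indexB]

theorem rootA_mk (k j : ℕ) : rootA ⟨k, j⟩ = factor (imagePos^[k + 1] 3 + j) (tau k) := rfl

theorem rootB_mk (k j : ℕ) :
    rootB ⟨k, j⟩ = factor (imagePos^[k + 2] 1 + j) (tau (k + 1) + tau k) := rfl

/-- Positions 3 and 1 are the first occurrences of c and b, so their images give the earliest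
repetitions of these types. -/
theorem trib_three : trib 3 = .c := rfl

theorem trib_one : trib 1 = .b := rfl

theorem three_le_of_trib_eq_c {i : ℕ} (h : trib i = .c) : 3 ≤ i := by
  by_contra hcon
  have h1 : i = 0 ∨ i = 1 ∨ i = 2 := by omega
  rcases h1 with rfl | rfl | rfl <;> exact absurd h (by decide)

theorem one_le_of_trib_eq_b {i : ℕ} (h : trib i = .b) : 1 ≤ i := by
  rcases i with _ | i
  · exact absurd h (by decide)
  · omega

theorem agree_rootA (k j e : ℕ) (h : j + e ≤ bispecialLength (k + 1)) :
    Agree (imagePos^[k + 1] 3 + j) (imagePos^[k + 1] 3 + j + tau k) e := by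
  have h1 := (agree_iterate_add (k + 1) 3).shift j e h
  rw [trib_three, imageLength_c] at h1
  rwa [Nat.add_right_comm]

theorem agree_rootB (k j e : ℕ) (h : j + e ≤ bispecialLength (k + 2)) :
    Agree (imagePos^[k + 2] 1 + j) (imagePos^[k + 2] 1 + j + (tau (k + 1) + tau k)) e := by
  have h1 := (agree_iterate_add (k + 2) 1).shift j e h
  rw [trib_one, imageLength_b] at h1
  rwa [Nat.add_right_comm]

/-- The prefix of length `b_(k+1)` recurs at the image of the first c, so the repetition generated
by a has the same roots as part of the one generated by c. -/
theorem rootA_eq (k j : ℕ) (h : j + tau k ≤ bispecialLength (k + 1)) :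
    factor j (tau k) = rootA ⟨k, j⟩ := by
  have h1 := (agree_zero_iterate (k + 1) 3).shift j (tau k) h
  rw [Nat.zero_add] at h1
  exact factor_eq_iff.2 h1

theorem lt_tau_of_mem_indexA {l k j : ℕ} (h : ⟨k, j⟩ ∈ indexA l) : j < tau k := by
  rw [mem_indexA_iff] at h
  have := bispecialLength_lt k
  have h2 := h.2
  split_ifs at h2 <;> omega

theorem rootA_injOn (l : ℕ) : Set.InjOn rootA (indexA l) := by
  have key : ∀ k j j', j < tau k → j' < tau k → j < j' → rootA ⟨k, j⟩ ≠ rootA ⟨k, j'⟩ := by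
    intro k j j' hj hj' hlt
    have h1 : bispecialLength (k + 1) = bispecialLength k + tau k := bispecialLength_succ k
    have h2 := tau_le k
    change factor (imagePos^[k + 1] 3 + j) (tau k) ≠ factor (imagePos^[k + 1] 3 + j') (tau k)
    exact IsPeriod.factor_ne (.inl ⟨k, rfl⟩) (agree_rootA k j _ (by omega))
      (agree_rootA k j' _ (by omega)) (by omega) (by omega)
  rintro ⟨k, j⟩ h ⟨k', j'⟩ h' heq
  have hl := congrArg List.length heq
  simp only [rootA, length_factor] at hl
  obtain rfl := tau_strictMono.injective hl
  have h1 := lt_tau_of_mem_indexA h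
  have h2 := lt_tau_of_mem_indexA h'
  rcases lt_trichotomy j j' with hlt | rfl | hlt
  · exact absurd heq (key _ _ _ h1 h2 hlt)
  · rfl
  · exact absurd heq.symm (key _ _ _ h2 h1 hlt)

theorem rootB_injOn (l : ℕ) : Set.InjOn rootB (indexB l) := by
  have key : ∀ k j j', j' ≤ bispecialLength k → j < j' → rootB ⟨k, j⟩ ≠ rootB ⟨k, j'⟩ := by
    intro k j j' hj' hlt
    have h1 := bispecialLength_add_two k
    have h2 := bispecialLength_lt_tau_succ k
    change factor (imagePos^[k + 2] 1 + j) (tau (k + 1) + tau k) ≠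
      factor (imagePos^[k + 2] 1 + j') (tau (k + 1) + tau k)
    exact IsPeriod.factor_ne (.inr ⟨k, rfl⟩) (agree_rootB k j _ (by omega))
      (agree_rootB k j' _ (by omega)) (by omega) (by omega)
  rintro ⟨k, j⟩ h ⟨k', j'⟩ h' heq
  have hl := congrArg List.length heq
  simp only [rootB, length_factor] at hl
  have hmono : StrictMono fun n => tau (n + 1) + tau n := fun m n hmn =>
    Nat.add_lt_add (tau_strictMono (Nat.succ_lt_succ hmn)) (tau_strictMono hmn)
  obtain rfl := hmono.injective hl
  rw [Finset.mem_coe, mem_indexB_iff] at h h'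
  rcases lt_trichotomy j j' with hlt | rfl | hlt
  · exact absurd heq (key _ _ _ (by omega) hlt)
  · rfl
  · exact absurd heq.symm (key _ _ _ (by omega) hlt)

theorem rootA_ne_rootB (p p' : (_ : ℕ) × ℕ) : rootA p ≠ rootB p' := by
  intro h
  have hl := congrArg List.length h
  simp only [rootA, rootB, length_factor] at hl
  have h1 := tau_add_lt p'.1
  have h2 := tau_pos p'.1
  have h3 := tau_strictMono.lt_iff_lt.1 (show tau p.1 < tau (p'.1 + 2) by omega)
  have h4 := tau_strictMono.lt_iff_lt.1 (show tau (p'.1 + 1) < tau p.1 by omega)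
  omega

theorem iterate_imagePos_three (k : ℕ) : imagePos^[k + 1] 3 = tau (k + 2) + tau (k + 1) := by
  have h1 : imagePos^[k + 1] 2 = _ := iterate_imagePos_succ (k + 1) 1
  have h2 : imagePos^[k + 1] 3 = _ := iterate_imagePos_succ (k + 1) 2
  have h3 := iterate_imagePos_one (k + 1)
  rw [trib_one] at h1
  rw [show trib 2 = .a from rfl] at h2
  rw [show tau (k + 2) = imageLength (k + 1) .a + imageLength (k + 1) .b from rfl]
  simp only [tau] at *
  omega

theorem squareRoots_subset {l : ℕ} {w : List Letter} (hw : w ∈ squareRoots (tau (l + 3))) :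
    (∃ p ∈ indexA l, rootA p = w) ∨ ∃ p ∈ indexB l, rootB p = w := by
  obtain ⟨s, q, hq, hs, ha, rfl⟩ := mem_squareRoots_iff.1 hw
  obtain ⟨k, i, j, rfl, rfl, h3⟩ := exists_letter hq (le_refl _) ha
  rcases hx : trib i with _ | _ | _ <;> rw [hx] at h3 hs
  · left
    have hb := bispecialLength_succ k
    have hlt := bispecialLength_lt k
    refine ⟨⟨k, j⟩, ?_, ?_⟩
    · rw [mem_indexA_iff]
      refine ⟨?_, ?_⟩
      -- For k ≥ l + 2 a square of root length `tau k` is already longer than `tau (l + 3)`.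
      · by_contra hcon
        have h4 := tau_strictMono.monotone (Nat.le_of_not_lt hcon)
        have h5 := tau_add_three l
        have h6 := tau_add_lt l
        simp only [tau] at *
        omega
      · split_ifs <;> simp only [tau] at * <;> omega
    · rw [← rootA_eq k j (by simp only [tau] at *; omega), factor_eq_iff]
      have h1 := (agree_zero_iterate k i).shift j (tau k) (by simp only [tau]; omega)
      rwa [Nat.zero_add] at h1
  · right
    rcases k with _ | _ | k
    · simp [imageLength, bispecialLength] at h3
    · have : bispecialLength 1 = 1 := rfl
      have : imageLength 1 .b = 2 := rfl
      simp only [Nat.zero_add] at h3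
      omega
    have hi := (iterate_imagePos_strictMono (k + 2)).monotone (one_le_of_trib_eq_b hx)
    have h1 := iterate_imagePos_one (k + 2)
    have hb := bispecialLength_add_two k
    have h2 := imageLength_b k
    simp only [Nat.add_assoc, Nat.reduceAdd] at *
    refine ⟨⟨k, j⟩, ?_, ?_⟩
    · rw [mem_indexB_iff]
      refine ⟨?_, by omega⟩
      -- The square starts no earlier than `tau (k + 2)`, so it ends beyond `tau (k + 3)`.
      by_contra hcon
      have h4 := tau_strictMono.monotone (Nat.add_le_add_right (Nat.le_of_not_lt hcon) 3)
      have h5 := tau_add_three k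
      have h6 := tau_pos k
      simp only [tau] at *
      omega
    · rw [rootB_mk, ← imageLength_b, factor_eq_iff]
      refine (agree_iterate (hx ▸ trib_one) (k + 2)).shift j _ ?_
      rw [trib_one]
      omega
  · left
    rcases k with _ | k
    · simp [imageLength, bispecialLength] at h3
    have hi := (iterate_imagePos_strictMono (k + 1)).monotone (three_le_of_trib_eq_c hx)
    have h1 := iterate_imagePos_three k
    have hb : bispecialLength (k + 1) = bispecialLength k + tau k := bispecialLength_succ k
    have hlt := bispecialLength_lt k
    rw [imageLength_c] at h3 hs
    rw [imageLength_c]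
    have hk : k < l := by
      by_contra hcon
      have h4 := tau_strictMono.monotone (Nat.add_le_add_right (Nat.le_of_not_lt hcon) 3)
      have h5 := tau_add_three k
      have h6 := tau_pos k
      omega
    have heq : rootA ⟨k, j⟩ = factor (imagePos^[k + 1] i + j) (tau k) := by
      rw [rootA_mk, factor_eq_iff]
      refine (agree_iterate (hx ▸ trib_three) (k + 1)).shift j _ ?_
      rw [trib_three, imageLength_c]
      omega
    rcases Nat.lt_or_ge j (tau k) with hj | hj
    · exact ⟨⟨k, j⟩, mem_indexA_iff.2 ⟨by omega, by rwa [if_pos hk]⟩, heq⟩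
    -- Here j ≤ `b_k` < 2 `tau k`, so subtracting one period gives an offset below `tau k` with the
    -- same root.
    · obtain ⟨j, rfl⟩ := Nat.exists_eq_add_of_le hj
      have hj' : j < tau k := by omega
      refine ⟨⟨k, j⟩, mem_indexA_iff.2 ⟨by omega, by rwa [if_pos hk]⟩, ?_⟩
      · rw [← heq, rootA_mk, rootA_mk, Nat.add_comm (tau k) j]
        refine factor_eq_iff.2 ?_
        rw [← Nat.add_assoc]
        exact agree_rootA k j _ (by omega)

theorem rootA_mem {l : ℕ} {p : (_ : ℕ) × ℕ} (hp : p ∈ indexA l) :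
    rootA p ∈ squareRoots (tau (l + 3)) := by
  obtain ⟨k, j⟩ := p
  have hj := lt_tau_of_mem_indexA hp
  have hb : bispecialLength (k + 1) = bispecialLength k + tau k := bispecialLength_succ k
  have hle := tau_le k
  rw [mem_indexA_iff] at hp
  obtain ⟨hp1, hp2⟩ := hp
  rw [mem_squareRoots_iff]
  rcases Nat.lt_or_ge k l with hk | hk
  · refine ⟨_, _, tau_pos k, ?_, agree_rootA k j _ (by omega), rfl⟩
    have h1 := iterate_imagePos_three k
    have h2 := tau_strictMono.monotone (show k + 4 ≤ l + 3 by omega)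
    have h3 := tau_add_three k
    have h4 := tau_add_three (k + 1)
    have h5 := tau_strictMono.monotone (show k ≤ k + 1 by omega)
    have h6 := tau_strictMono.monotone (show k ≤ k + 2 by omega)
    simp only [Nat.add_assoc, Nat.reduceAdd] at h4
    omega
  · rw [if_neg (by omega)] at hp2
    -- The witness is the repetition at position 0, generated by the initial a.
    refine ⟨j, tau k, tau_pos k, ?_, ?_, (rootA_eq k j (by omega)).symm⟩
    · have h1 := bispecialLength_lt_tau_succ (k + 1)
      have h2 := tau_strictMono.monotone (show k + 2 ≤ l + 3 by omega)
      simp only [Nat.add_assoc, Nat.reduceAdd] at h1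
      omega
    · have h1 := (agree_zero_iterate k 1).shift j (tau k) (by omega)
      rwa [iterate_imagePos_one, Nat.zero_add, Nat.add_comm _ j] at h1

theorem rootB_mem {l : ℕ} {p : (_ : ℕ) × ℕ} (hp : p ∈ indexB l) :
    rootB p ∈ squareRoots (tau (l + 3)) := by
  obtain ⟨k, j⟩ := p
  rw [mem_indexB_iff] at hp
  obtain ⟨hp1, hp2⟩ := hp
  have hb := bispecialLength_add_two k
  have h0 := tau_pos k
  rw [mem_squareRoots_iff]
  refine ⟨_, _, by omega, ?_, agree_rootB k j _ (by omega), rfl⟩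
  have h1 := iterate_imagePos_one (k + 2)
  have h2 := tau_strictMono.monotone (show k + 4 ≤ l + 3 by omega)
  have h3 := tau_add_three k
  have h4 := tau_add_three (k + 1)
  have h5 := (imageLength_bounds (k + 2)).2.2.2.2.1
  rw [imageLength_c] at h5
  simp only [Nat.add_assoc, Nat.reduceAdd] at h4
  simp only [tau] at *
  omega

/-! ### The count and its closed forms. -/

theorem A_tau (l : ℕ) :
    A (tau (l + 3)) = ∑ k ∈ Finset.range l, (tau k + (bispecialLength k + 1)) +
      (bispecialLength l + 1 - tau l) + (bispecialLength (l + 1) + 1 - tau (l + 1)) := by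
  have h : squareRoots (tau (l + 3)) =
      (((indexA l).image rootA ∪ (indexB l).image rootB : Finset (List Letter)) :
        Set (List Letter)) := by
    ext w
    rw [Finset.mem_coe, Finset.mem_union, Finset.mem_image, Finset.mem_image]
    refine ⟨squareRoots_subset, ?_⟩
    rintro (⟨p, hp, rfl⟩ | ⟨p, hp, rfl⟩)
    · exact rootA_mem hp
    · exact rootB_mem hp
  have hdisj : Disjoint ((indexA l).image rootA) ((indexB l).image rootB) := by
    rw [Finset.disjoint_left]
    intro w hw hw'
    obtain ⟨p, -, rfl⟩ := Finset.mem_image.1 hw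
    obtain ⟨p', -, hp'⟩ := Finset.mem_image.1 hw'
    exact rootA_ne_rootB p p' hp'.symm
  rw [A, h, Set.ncard_coe_finset, Finset.card_union_of_disjoint hdisj,
    Finset.card_image_of_injOn (rootA_injOn l), Finset.card_image_of_injOn (rootB_injOn l),
    indexA, indexB, Finset.card_sigma, Finset.card_sigma]
  simp only [Finset.card_range]
  rw [Finset.sum_range_succ, Finset.sum_range_succ]
  simp only [Finset.sum_add_distrib]
  have h1 : ∑ k ∈ Finset.range l, (if k < l then tau k else bispecialLength k + 1 - tau k) =
      ∑ k ∈ Finset.range l, tau k :=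
    Finset.sum_congr rfl fun k hk => if_pos (Finset.mem_range.1 hk)
  rw [h1, if_neg (lt_irrefl l), if_neg (by omega)]
  omega

theorem two_mul_bispecialLength (k : ℕ) : 2 * bispecialLength k + 3 + tau k = tau (k + 2) := by
  induction k with
  | zero => rfl
  | succ k ih =>
    have h1 := bispecialLength_succ k
    have h2 := tau_add_three k
    simp only [tau, Nat.add_assoc, Nat.reduceAdd] at *
    omega

theorem sum_range_tau (k : ℕ) : ∑ i ∈ Finset.range k, tau i = bispecialLength k := by
  induction k with
  | zero => rfl
  | succ k ih => rw [Finset.sum_range_succ, ih, bispecialLength_succ]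

/-- Glen's numbers with nonnegative index are the lengths of the bispecial prefixes. -/
theorem d_natCast (k : ℕ) : d k = bispecialLength k := by
  rcases k with _ | k
  · rfl
  have h1 : ((k + 1 : ℕ) : ℤ) + 1 = ((k + 2 : ℕ) : ℤ) := by push_cast; ring
  have h2 : ((k + 1 : ℕ) : ℤ) - 1 = (k : ℤ) := by push_cast; ring
  have h3 := two_mul_bispecialLength k
  have h4 := bispecialLength_succ k
  have h5 : (2 * bispecialLength (k + 1) + 3 : ℚ) = tau (k + 2) + tau k := by
    have : 2 * bispecialLength (k + 1) + 3 = tau (k + 2) + tau k := by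
      simp only [tau] at *
      omega
    exact_mod_cast this
  rw [d, if_neg (by omega), if_neg (by omega), h1, h2, t_natCast, t_natCast]
  simp only [tau] at h5
  linarith

theorem A_tau_cast (l : ℕ) :
    (A (tau (l + 3)) : ℚ) = ∑ k ∈ Finset.range l, ((bispecialLength k : ℚ) + 1) +
      3 * bispecialLength l + 2 - tau (l + 1) := by
  have h1 := A_tau l
  have h2 := tau_le l
  have h3 := tau_le (l + 1)
  have h4 := bispecialLength_succ l
  simp only [Finset.sum_add_distrib, sum_range_tau] at h1
  -- The truncated subtractions in `A_tau` are exact by `tau_le`; the negative term is moved across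
  -- before casting.
  have h5 : A (tau (l + 3)) + tau (l + 1) =
      ∑ k ∈ Finset.range l, (bispecialLength k + 1) + 3 * bispecialLength l + 2 := by
    simp only [tau, Finset.sum_add_distrib] at *
    omega
  have h6 := congrArg (Nat.cast (R := ℚ)) h5
  push_cast at h6
  linarith

theorem tau_add_three_cast (k : ℕ) : (tau (k + 3) : ℚ) = tau (k + 2) + tau (k + 1) + tau k := by
  exact_mod_cast tau_add_three k

theorem two_mul_bispecialLength_cast (k : ℕ) :
    (2 * bispecialLength k + 3 + tau k : ℚ) = tau (k + 2) := by
  exact_mod_cast two_mul_bispecialLength k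

theorem A_tau_formula (l : ℕ) :
    2 * (A (tau (l + 4)) : ℚ) = 2 * tau (l + 2) + tau (l + 1) + 3 * tau l - l - 9 := by
  rw [A_tau_cast]
  induction l with
  | zero => norm_num [Finset.sum_range_succ, bispecialLength, imageLength, imagePos_zero]
  | succ l ih =>
    rw [Finset.sum_range_succ]
    have h1 := two_mul_bispecialLength_cast (l + 1)
    have h2 := two_mul_bispecialLength_cast (l + 2)
    have h3 := tau_add_three_cast l
    have h4 := tau_add_three_cast (l + 1)
    simp only [Nat.add_assoc, Nat.reduceAdd] at *
    push_cast
    linarith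

theorem A_tau_zero : A (tau 3) = 0 := by
  have h := A_tau 0
  simpa [bispecialLength, imageLength, imagePos_zero] using h

theorem A_mono {m n : ℕ} (h : m ≤ n) : A m ≤ A n :=
  Set.ncard_le_ncard (fun _ hw => ⟨hw.1, hw.2.trans (tribPrefix_prefix h).isInfix⟩)
    (squareRoots_finite n)

theorem d_of_neg {j : ℤ} (h : j < 0) : d j = -1 := if_pos h

theorem A_tau_glen (l : ℕ) :
    (A (tau (l + 3)) : ℚ) = ∑ i ∈ Finset.range (l + 1), (d i + 1) +
      d ((l : ℤ) - 2) + d ((l : ℤ) - 3) + 1 := by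
  have h0 : ∑ i ∈ Finset.range (l + 1), (d i + 1) =
      ∑ k ∈ Finset.range l, ((bispecialLength k : ℚ) + 1) + (bispecialLength l + 1) := by
    simp only [d_natCast]
    exact Finset.sum_range_succ _ _
  rw [A_tau_cast, h0]
  -- For l ≤ 2 at least one index of `d` is negative and takes the conventional value -1.
  rcases l with _ | _ | _ | l
  · norm_num [d_of_neg, bispecialLength, imageLength]
  · norm_num [d_of_neg, bispecialLength, imageLength, imagePos_zero]
  · have h1 : d 0 = 0 := rfl
    have h2 : bispecialLength 2 = 3 := rfl
    norm_num [d_of_neg, imageLength, h1, h2]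
    ring
  · have e1 : ((l + 1 + 1 + 1 : ℕ) : ℤ) - 2 = (l + 1 : ℕ) := by push_cast; ring
    have e2 : ((l + 1 + 1 + 1 : ℕ) : ℤ) - 3 = (l : ℕ) := by push_cast; ring
    rw [e1, e2, d_natCast, d_natCast]
    have h1 := two_mul_bispecialLength_cast l
    have h2 := two_mul_bispecialLength_cast (l + 1)
    have h3 := two_mul_bispecialLength_cast (l + 2)
    have h4 : (bispecialLength (l + 1) : ℚ) = bispecialLength l + tau l := by
      exact_mod_cast bispecialLength_succ l
    have h5 : (bispecialLength (l + 3) : ℚ) = bispecialLength (l + 2) + tau (l + 2) := by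
      exact_mod_cast bispecialLength_succ (l + 2)
    have h6 := tau_add_three_cast (l + 1)
    simp only [Nat.add_assoc, Nat.reduceAdd] at *
    linarith

end Tribonacci

theorem mainTheorem2 :
    (∀ m : ℕ, m ≤ 2 → Tribonacci.A (Tribonacci.t m) = 0) ∧
    (∀ m : ℕ, 3 ≤ m →
      (Tribonacci.A (Tribonacci.t m) : ℚ) =
          (2 * (Tribonacci.t ((m : ℤ) - 2) : ℚ) + (Tribonacci.t ((m : ℤ) - 3) : ℚ)
            + 3 * (Tribonacci.t ((m : ℤ) - 4) : ℚ) - (m : ℚ) - 5) / 2 ∧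
      (Tribonacci.A (Tribonacci.t m) : ℚ) =
          (∑ i ∈ Finset.range (m - 2), (Tribonacci.d (i : ℤ) + 1))
            + Tribonacci.d ((m : ℤ) - 5) + Tribonacci.d ((m : ℤ) - 6) + 1) := by
  open Tribonacci in
  refine ⟨fun m hm => ?_, fun m hm => ⟨?_, ?_⟩⟩
  · rw [t_natCast]
    have h1 := A_mono (tau_strictMono.monotone (show m ≤ 3 by omega))
    rw [A_tau_zero] at h1
    exact Nat.le_zero.1 h1
  · rw [t_natCast]
    obtain ⟨l, rfl⟩ := Nat.exists_eq_add_of_le' hm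
    -- The case m = 3 is separate because it involves `t (-1)`, the length of the conventional word
    -- c.
    rcases l with _ | l
    · have h1 : A (imageLength (0 + 3) .a) = 0 := A_tau_zero
      have h2 : t (((0 + 3 : ℕ) : ℤ) - 2) = 2 := rfl
      have h3 : t (((0 + 3 : ℕ) : ℤ) - 3) = 1 := rfl
      have h4 : t (((0 + 3 : ℕ) : ℤ) - 4) = 1 := rfl
      rw [h1, h2, h3, h4]
      norm_num
    · have e1 : ((l + 1 + 3 : ℕ) : ℤ) - 2 = (l + 2 : ℕ) := by push_cast; ring
      have e2 : ((l + 1 + 3 : ℕ) : ℤ) - 3 = (l + 1 : ℕ) := by push_cast; ring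
      have e3 : ((l + 1 + 3 : ℕ) : ℤ) - 4 = (l : ℕ) := by push_cast; ring
      have h := A_tau_formula l
      rw [e1, e2, e3, t_natCast, t_natCast, t_natCast]
      simp only [tau] at h
      rw [show l + 1 + 3 = l + 4 by omega]
      push_cast
      linarith
  · rw [t_natCast]
    obtain ⟨l, rfl⟩ := Nat.exists_eq_add_of_le' hm
    have e1 : ((l + 3 : ℕ) : ℤ) - 5 = (l : ℤ) - 2 := by push_cast; ring
    have e2 : ((l + 3 : ℕ) : ℤ) - 6 = (l : ℤ) - 3 := by push_cast; ring
    rw [e1, e2, show l + 3 - 2 = l + 1 by omega]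
    exact A_tau_glen l
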